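/- Let $\mathbf{R}$ be an integral ring (a commutative ring in which every element is zero or regular; the trivial ring is allowed), let $\mathbf{K}=\operatorname{Frac}\mathbf{R}$ be its field of fractions, and let $n\ge -1$ be an integer. Then $$\operatorname{vdim}\mathbf{R}\le n\ \Longrightarrow\ \operatorname{Vdim}\mathbf{R}\le n ,$$ where the two notions are defined as follows. * $\operatorname{vdim}\mathbf{R}\le n$ means that for every finite sequence $x_1,\dots,x_m$ in $\mathbf{K}$ the ring $\mathbf{R}[x_1,\dots,x_m]\subseteq\mathbf{K}$ has Krull dimension $\le n$. (A ring has Krull dimension $\le -1$ iff it is trivial.) * $\operatorname{Vdim}\mathbf{R}\le n$ means that the distributive lattice $\operatorname{Val}(\mathbf{R})$ has Krull dimension $\le n$. Here a bounded distributive lattice $\mathbf{T}$ has Krull dimension $\le n$ if for all $x_0,\dots,x_n\in\mathbf{T}$ there are $y_0,\dots,y_n\in\mathbf{T}$ with $$1\le y_n\vee x_n,\qquad y_i\wedge x_i\le y_{i-1}\vee x_{i-1}\ (1\le i\le n),\qquad y_0\wedge x_0\le 0,$$ and $\mathbf{T}$ has Krull dimension $\le -1$ if it is trivial ($1\le 0$).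 * $\operatorname{Val}(\mathbf{R})$ is the bounded distributive lattice generated by symbols indexed by $\mathbf{K}^\times$, with a relation $x_1\wedge\dots\wedge x_p\le y_1\vee\dots\vee y_q$ whenever $$\operatorname{Vr}(x_1),\dots,\operatorname{Vr}(x_p)\vdash \operatorname{Vr}(y_1)\text{ or }\dots\text{ or }\operatorname{Vr}(y_q)$$ is provable in the following dynamical theory of valuation rings of $\mathbf{K}$ containing $\mathbf{R}$. The terms are the ring expressions in constants for the elements of $\mathbf{K}$ and in variables, taken modulo the identities of commutative rings; the atomic formulas are $t=0$ and $\operatorname{Vr}(t)$, and $s=t$ stands for $s-t=0$. The axioms are those of nontrivial discrete fields ($\vdash 0=0$; $\ x=0,\,y=0\vdash x+y=0$; $\ x=0\vdash xy=0$; $\ 1=0\vdash\bot$; $\ \vdash x=0$ or $\exists y\ xy=1$), the diagram of $\mathbf{K}$ ($\vdash 0_{\mathbf{K}}=0$; $\ \vdash 1_{\mathbf{K}}=1$; $\ \vdash a+b=c$ if $a+b=_{\mathbf{K}}c$; $\ \vdash ab=c$ if $ab=_{\mathbf{K}}c$), and, for the predicate $\operatorname{Vr}$: $\ \vdash\operatorname{Vr}(a)$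 for $a\in\mathbf{R}$; $\ \operatorname{Vr}(x),\operatorname{Vr}(y)\vdash\operatorname{Vr}(xy)$; $\ \operatorname{Vr}(x),\operatorname{Vr}(y)\vdash\operatorname{Vr}(x+y)$; $\ xy=1\vdash\operatorname{Vr}(x)$ or $\operatorname{Vr}(y)$; together with the substitution of equals $x=y,\operatorname{Vr}(x)\vdash\operatorname{Vr}(y)$. Provability is by finite trees: starting from the hypotheses, at each node one applies an axiom whose premises are already available and opens one branch for each disjunct of its conclusion (with a fresh variable for an existential quantifier), and each branch must end with one of the wanted conclusions or with $\bot$. -/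

import Mathlib

noncomputable section

/-! ### Distributive lattices generated by a relation between finite families -/

/-- Formal expressions in the language of bounded lattices, with generators from `S`. -/
inductive LatTerm (S : Type*) where
  | gen (s : S) : LatTerm S
  | top : LatTerm S
  | bot : LatTerm S
  | inf (a b : LatTerm S) : LatTerm S
  | sup (a b : LatTerm S) : LatTerm S

namespace LatTerm

variable {S : Type*}

/-- The meet of a finitely enumerated family of generators (`⊤` for the empty family). -/
def meet (A : List S) : LatTerm S := A.foldr (fun s t => inf (gen s) t) top

/-- The join of a finitely enumerated family of generators (`⊥` for the empty family). -/
def join (B : List S) : LatTerm S := B.foldr (fun s t => sup (gen s) t) bot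

/-- The least preorder on lattice expressions which satisfies the laws of bounded distributive
lattices and such that `⋀ A ≤ ⋁ B` whenever `ent A B`. -/
inductive Le (ent : List S → List S → Prop) : LatTerm S → LatTerm S → Prop
  | refl (a) : Le ent a a
  | trans {a b c} : Le ent a b → Le ent b c → Le ent a c
  | le_top (a) : Le ent a top
  | bot_le (a) : Le ent bot a
  | inf_le_left (a b) : Le ent (inf a b) a
  | inf_le_right (a b) : Le ent (inf a b) b
  | le_inf {a b c} : Le ent a b → Le ent a c → Le ent a (inf b c)
  | le_sup_left (a b) : Le ent a (sup a b)
  | le_sup_right (a b) : Le ent b (sup a b)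
  | sup_le {a b c} : Le ent a c → Le ent b c → Le ent (sup a b) c
  | le_sup_inf (a b c) : Le ent (inf (sup a b) (sup a c)) (sup a (inf b c))
  | of_ent {A B} : ent A B → Le ent (meet A) (join B)

/-- Two expressions are identified when each is below the other. -/
def setoid (ent : List S → List S → Prop) : Setoid (LatTerm S) where
  r a b := Le ent a b ∧ Le ent b a
  iseqv := ⟨fun a => ⟨.refl a, .refl a⟩, fun h => ⟨h.2, h.1⟩,
    fun h k => ⟨.trans h.1 k.1, .trans k.2 h.2⟩⟩

end LatTerm

/-- The bounded distributive lattice with set of generators `S` and with the relations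
`⋀ A ≤ ⋁ B` for all finite families `A`, `B` such that `ent A B`. -/
def GenLattice {S : Type*} (ent : List S → List S → Prop) : Type _ :=
  Quotient (LatTerm.setoid ent)

namespace GenLattice

variable {S : Type*} {ent : List S → List S → Prop}

/-- The class of a generator. -/
def gen (ent : List S → List S → Prop) (s : S) : GenLattice ent :=
  Quotient.mk (LatTerm.setoid ent) (.gen s)

instance : LE (GenLattice ent) where
  le := Quotient.lift₂ (LatTerm.Le ent) fun _ _ _ _ h k => propext
    ⟨fun l => .trans h.2 (.trans l k.1), fun l => .trans h.1 (.trans l k.2)⟩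

instance : Max (GenLattice ent) where
  max := Quotient.map₂ LatTerm.sup fun _ _ h _ _ k =>
    ⟨.sup_le (.trans h.1 (.le_sup_left _ _)) (.trans k.1 (.le_sup_right _ _)),
      .sup_le (.trans h.2 (.le_sup_left _ _)) (.trans k.2 (.le_sup_right _ _))⟩

instance : Min (GenLattice ent) where
  min := Quotient.map₂ LatTerm.inf fun _ _ h _ _ k =>
    ⟨.le_inf (.trans (.inf_le_left _ _) h.1) (.trans (.inf_le_right _ _) k.1),
      .le_inf (.trans (.inf_le_left _ _) h.2) (.trans (.inf_le_right _ _) k.2)⟩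

instance : DistribLattice (GenLattice ent) where
  le_refl := by rintro ⟨a⟩; exact LatTerm.Le.refl a
  le_trans := by rintro ⟨a⟩ ⟨b⟩ ⟨c⟩ h k; exact LatTerm.Le.trans h k
  le_antisymm := by rintro ⟨a⟩ ⟨b⟩ h k; exact Quotient.sound ⟨h, k⟩
  sup := max
  le_sup_left := by rintro ⟨a⟩ ⟨b⟩; exact LatTerm.Le.le_sup_left a b
  le_sup_right := by rintro ⟨a⟩ ⟨b⟩; exact LatTerm.Le.le_sup_right a b
  sup_le := by rintro ⟨a⟩ ⟨b⟩ ⟨c⟩ h k; exact LatTerm.Le.sup_le h k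
  inf := min
  inf_le_left := by rintro ⟨a⟩ ⟨b⟩; exact LatTerm.Le.inf_le_left a b
  inf_le_right := by rintro ⟨a⟩ ⟨b⟩; exact LatTerm.Le.inf_le_right a b
  le_inf := by rintro ⟨a⟩ ⟨b⟩ ⟨c⟩ h k; exact LatTerm.Le.le_inf h k
  le_sup_inf := by rintro ⟨a⟩ ⟨b⟩ ⟨c⟩; exact LatTerm.Le.le_sup_inf a b c

instance : BoundedOrder (GenLattice ent) where
  top := Quotient.mk (LatTerm.setoid ent) .top
  le_top := by rintro ⟨a⟩; exact LatTerm.Le.le_top a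
  bot := Quotient.mk (LatTerm.setoid ent) .bot
  bot_le := by rintro ⟨a⟩; exact LatTerm.Le.bot_le a

end GenLattice

/-! ### Krull dimension -/

/-- The sequence `y_0, …, y_{k-1}` is complementary to `x_0, …, x_{k-1}`:
`⊤ ≤ y_{k-1} ⊔ x_{k-1}`, `y_i ⊓ x_i ≤ y_{i-1} ⊔ x_{i-1}` for `0 < i < k`, and `y_0 ⊓ x_0 ≤ ⊥`.
For `k = 0` this means `⊤ ≤ ⊥`. -/
def IsComplementarySeq {T : Type*} [DistribLattice T] [BoundedOrder T] {k : ℕ}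
    (x y : Fin k → T) : Prop :=
  ∀ i : Fin (k + 1),
    (Fin.snoc (fun j => y j ⊓ x j) ⊤ : Fin (k + 1) → T) i ≤
      (Fin.cons ⊥ (fun j => y j ⊔ x j) : Fin (k + 1) → T) i

/-- The Krull dimension of the distributive lattice `T` is at most `n`, for an integer `n ≥ -1`:
every sequence `x_0, …, x_n` in `T` has a complementary sequence in `T`. For `n = -1` this means
that `T` is trivial. -/
def LatticeKdimLE (T : Type*) [DistribLattice T] [BoundedOrder T] (n : ℤ) : Prop :=
  ∀ x : Fin (n + 1).toNat → T, ∃ y : Fin (n + 1).toNat → T, IsComplementarySeq x y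

/-- The Krull dimension of the commutative ring `A` is at most `n`, i.e. less than `n + 1`, for an
integer `n ≥ -1`. For `n = -1` this means that `A` is trivial. -/
def RingKdimLE (A : Type*) [CommRing A] (n : ℤ) : Prop :=
  ringKrullDim A < (((n + 1).toNat : ℕ) : WithBot ℕ∞)

/-! ### The dynamical theory of valuation rings of `K` containing `R` -/

/-- Terms of the theory: ring expressions in the elements of `K` (the constants, `Sum.inl`) and in
variables (`Sum.inr`). Computations in commutative rings are part of the background of the theory,
so terms are polynomials with integer coefficients in these symbols. -/
abbrev ValTerm (K : Type*) : Type _ := MvPolynomial (K ⊕ ℕ) ℤ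

/-- The constant of the theory that names `a : K`. -/
def ValTerm.const {K : Type*} (a : K) : ValTerm K := MvPolynomial.X (Sum.inl a)

/-- The `i`-th variable. -/
def ValTerm.var {K : Type*} (i : ℕ) : ValTerm K := MvPolynomial.X (Sum.inr i)

/-- Atomic formulas `t = 0` and `Vr(t)`. -/
inductive ValAtom (K : Type*) where
  | isZero (t : ValTerm K) : ValAtom K
  | Vr (t : ValTerm K) : ValAtom K

namespace ValAtom

variable {K : Type*}

/-- The formula `s = t`, that is, `s - t = 0`. -/
def eq (s t : ValTerm K) : ValAtom K := isZero (s - t)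

/-- The term of an atomic formula. -/
def term : ValAtom K → ValTerm K
  | isZero t => t
  | Vr t => t

/-- The `i`-th variable does not occur in the formula. -/
def Fresh (i : ℕ) (A : ValAtom K) : Prop := Sum.inr i ∉ A.term.vars

end ValAtom

open ValAtom ValTerm in
/-- The axioms of the theory that have no existential quantifier. `ValAxiom R K H D` says that
`H ⊢ ⋁ D` is an instance of an axiom, where `H` is a conjunction of atomic formulas and `D` is a
disjunction of conjunctions of atomic formulas (`⊥` if `D = []`). -/
inductive ValAxiom (R K : Type*) [CommRing R] [CommRing K] [Algebra R K] :
    List (ValAtom K) → List (List (ValAtom K)) → Prop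
  | zero : ValAxiom R K [] [[isZero 0]]
  | add (x y) : ValAxiom R K [isZero x, isZero y] [[isZero (x + y)]]
  | mul (x y) : ValAxiom R K [isZero x] [[isZero (x * y)]]
  | one_eq_zero : ValAxiom R K [isZero 1] []
  | const_zero : ValAxiom R K [] [[eq (const 0) 0]]
  | const_one : ValAxiom R K [] [[eq (const 1) 1]]
  | const_add (a b : K) : ValAxiom R K [] [[eq (const a + const b) (const (a + b))]]
  | const_mul (a b : K) : ValAxiom R K [] [[eq (const a * const b) (const (a * b))]]
  | Vr_congr (x y) : ValAxiom R K [eq x y, Vr x] [[Vr y]]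
  | Vr_const (r : R) : ValAxiom R K [] [[Vr (const (algebraMap R K r))]]
  | Vr_mul (x y) : ValAxiom R K [Vr x, Vr y] [[Vr (x * y)]]
  | Vr_add (x y) : ValAxiom R K [Vr x, Vr y] [[Vr (x + y)]]
  | Vr_or (x y) : ValAxiom R K [eq (x * y) 1] [[Vr x], [Vr y]]

open ValAtom ValTerm in
/-- Dynamical proofs: `ValDerives R K Γ Δ` says that from the facts in `Γ` one can prove the
disjunction of the formulas in `Δ` by a finite tree. A branch ends when one of its facts is
in `Δ`; otherwise an axiom whose hypotheses are among the facts of the branch is applied, and the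
tree splits into one branch for each disjunct of its conclusion (no branch if this is `⊥`). The
constructor `inv` applies the axiom `⊢ x = 0 or ∃ y, x * y = 1`, with a fresh variable for `y`. -/
inductive ValDerives (R K : Type*) [CommRing R] [CommRing K] [Algebra R K] :
    List (ValAtom K) → List (ValAtom K) → Prop
  | leaf {Γ Δ} (A : ValAtom K) : A ∈ Γ → A ∈ Δ → ValDerives R K Γ Δ
  | ax {Γ Δ H D} : ValAxiom R K H D → (∀ A ∈ H, A ∈ Γ) →
      (∀ C ∈ D, ValDerives R K (C ++ Γ) Δ) → ValDerives R K Γ Δ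
  | inv {Γ Δ} (x : ValTerm K) (i : ℕ) : Sum.inr i ∉ x.vars →
      (∀ A ∈ Γ, A.Fresh i) → (∀ A ∈ Δ, A.Fresh i) →
      ValDerives R K (isZero x :: Γ) Δ → ValDerives R K (eq (x * var i) 1 :: Γ) Δ →
      ValDerives R K Γ Δ

/-! ### The valuative lattice and the two valuative dimensions -/

/-- The entailment relation on `Kˣ`:
`Vr(x_1), …, Vr(x_p) ⊢ Vr(y_1) or … or Vr(y_q)` is provable. -/
def ValEntails (R K : Type*) [CommRing R] [CommRing K] [Algebra R K] (A B : List Kˣ) : Prop :=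
  ValDerives R K (A.map fun x => .Vr (.const (x : K))) (B.map fun y => .Vr (.const (y : K)))

/-- The valuative lattice `Val(K, R)`. -/
abbrev ValLattice (R K : Type*) [CommRing R] [CommRing K] [Algebra R K] : Type _ :=
  GenLattice (ValEntails R K)

/-- `vdim R ≤ n`, where `K` is the ring of fractions of `R`: all the rings
`R[x_1, …, x_m] ⊆ K` have Krull dimension at most `n`. -/
def SmallVdimLE (R K : Type*) [CommRing R] [CommRing K] [Algebra R K] (n : ℤ) : Prop :=
  ∀ (m : ℕ) (x : Fin m → K), RingKdimLE (Algebra.adjoin R (Set.range x)) n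

/-- `Vdim R ≤ n`, where `K` is the ring of fractions of `R`: the Krull dimension of the valuative
lattice of `R` is at most `n`. -/
def BigVdimLE (R K : Type*) [CommRing R] [CommRing K] [Algebra R K] (n : ℤ) : Prop :=
  LatticeKdimLE (ValLattice R K) n

end

/-! ### Krull dimension of a lattice via chains of prime ideals. -/

section LatticeChains

open Order

variable {T : Type*} [DistribLattice T] [BoundedOrder T]

/-! Put k = n + 1. By the prime ideal theorem, a sequence of length k without a complement gives a
strict chain of k + 1 primes in Val(R) (`exists_isComplementarySeq`). The generators outside a
prime, together with 0, form a valuation ring of K containing R, and larger primes give smaller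
rings, so V_0 > ... > V_k (`ValLattice.valuationSubring_lt`). Their maximal ideals increase
strictly. Choosing x_i in m_{i+1} but not in m_i makes the traces of the m_j on R[x_0, ..., x_{k-1}]
a strict chain of k + 1 primes, so this ring has dimension at least k
(`exists_le_ringKrullDim_adjoin`), against vdim R ≤ n. -/

/-- The ideal `(I : a) ⊔ ↓a` of a distributive lattice. -/
def boundaryIdeal (I : Ideal T) (a : T) : Ideal T :=
  IsIdeal.toIdeal (I := {z | ∃ y, y ⊓ a ∈ I ∧ z ≤ y ⊔ a})
    { IsLowerSet := fun _ _ hle ⟨y, hy, hz⟩ => ⟨y, hy, hle.trans hz⟩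
      Nonempty := ⟨⊥, ⊥, by simp, bot_le⟩
      Directed := by
        rintro z ⟨y, hy, hz⟩ z' ⟨y', hy', hz'⟩
        refine ⟨z ⊔ z', ⟨y ⊔ y', ?_, ?_⟩, le_sup_left, le_sup_right⟩
        · rw [inf_sup_right]
          exact Ideal.sup_mem hy hy'
        · exact sup_le (hz.trans (sup_le_sup_right le_sup_left _))
            (hz'.trans (sup_le_sup_right le_sup_right _)) }

theorem mem_boundaryIdeal {I : Ideal T} {a z : T} :
    z ∈ boundaryIdeal I a ↔ ∃ y, y ⊓ a ∈ I ∧ z ≤ y ⊔ a :=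
  Iff.rfl

/-- The ideals obtained from `⊥` by taking boundaries along the sequence `x`. -/
def iteratedBoundary (x : ℕ → T) : ℕ → Ideal T
  | 0 => ⊥
  | k + 1 => boundaryIdeal (iteratedBoundary x k) (x k)

/-- Each boundary membership supplies one witness y, and y ⊓ a falls back into the previous ideal. A
general z replaces ⊤ so that the induction can continue with y ⊓ a. -/
theorem exists_partial_complementary (x : ℕ → T) (k : ℕ) (z : T)
    (hz : z ∈ iteratedBoundary x k) :
    ∃ y : Fin k → T, ∀ i : Fin (k + 1),
      (Fin.snoc (fun j => y j ⊓ x j) z : Fin (k + 1) → T) i ≤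
        (Fin.cons ⊥ (fun j => y j ⊔ x j) : Fin (k + 1) → T) i := by
  induction k generalizing z with
  | zero =>
    refine ⟨Fin.elim0, fun i => ?_⟩
    obtain rfl : i = Fin.last 0 := Fin.ext (by simp)
    rw [Fin.snoc_last]
    exact hz
  | succ k ih =>
    obtain ⟨a, ha, hza⟩ := mem_boundaryIdeal.1 hz
    obtain ⟨y, hy⟩ := ih _ ha
    refine ⟨Fin.snoc y a, fun i => ?_⟩
    induction i using Fin.lastCases with
    | last =>
      rw [Fin.snoc_last, ← Fin.succ_last, Fin.cons_succ, Fin.snoc_last]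
      exact hza
    | cast i =>
      have h := hy i
      rw [Fin.snoc_castSucc]
      convert h using 1
      · induction i using Fin.lastCases with
        | last => simp
        | cast i => simp
      · induction i using Fin.cases with
        | zero => simp
        | succ i => rw [← Fin.succ_castSucc]; simp

/-- A prime ideal containing the boundary of `I` at `a` contains strictly a prime ideal
containing `I`. -/
theorem exists_isPrime_lt_of_boundaryIdeal_le {I J : Ideal T} {a : T} (hJ : J.IsPrime)
    (h : boundaryIdeal I a ≤ J) : ∃ P : Ideal T, P.IsPrime ∧ I ≤ P ∧ P < J := by
  -- This is the filter generated by a and the complement of J. A prime avoiding it lies inside J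
  -- and misses a, while a ∈ J.
  have hF : IsPFilter {z | ∃ b, b ∉ J ∧ b ⊓ a ≤ z} := by
    refine .of_def ⟨a, ⊤, ?_, inf_le_right⟩ ?_ ?_
    · exact hJ.toIsProper.top_notMem
    · rintro z ⟨b, hb, hz⟩ z' ⟨b', hb', hz'⟩
      refine ⟨z ⊓ z', ⟨b ⊓ b', fun hbb => (hJ.mem_or_mem hbb).elim hb hb', ?_⟩,
        inf_le_left, inf_le_right⟩
      exact le_inf ((inf_le_inf_right _ inf_le_left).trans hz)
        ((inf_le_inf_right _ inf_le_right).trans hz')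
    · rintro z z' hle ⟨b, hb, hz⟩
      exact ⟨b, hb, hz.trans hle⟩
  have hdisj : Disjoint (hF.toPFilter : Set T) (I : Set T) := by
    rw [Set.disjoint_left]
    rintro z ⟨b, hb, hz⟩ hzI
    exact hb (h (mem_boundaryIdeal.2 ⟨b, I.lower hz hzI, le_sup_left⟩))
  obtain ⟨P, hP, hIP, hd⟩ := DistribLattice.prime_ideal_of_disjoint_filter_ideal hdisj
  rw [Set.disjoint_left] at hd
  refine ⟨P, hP, hIP, lt_of_le_of_ne (fun z hz => ?_) ?_⟩
  · by_contra hzJ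
    exact hd ⟨z, hzJ, inf_le_left⟩ hz
  · rintro rfl
    exact hd ⟨⊤, hJ.toIsProper.top_notMem, inf_le_right⟩
      (h (mem_boundaryIdeal.2 ⟨⊥, by simp, le_sup_right⟩))

theorem exists_strictMono_isPrime (x : ℕ → T) (k : ℕ) (J : Ideal T) (hJ : J.IsPrime)
    (h : iteratedBoundary x k ≤ J) :
    ∃ p : Fin (k + 1) → Ideal T, (∀ i, (p i).IsPrime) ∧ StrictMono p ∧ p (Fin.last k) = J := by
  induction k generalizing J with
  | zero =>
    exact ⟨fun _ => J, fun _ => hJ, Fin.strictMono_iff_lt_succ.2 fun i => i.elim0, rfl⟩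
  | succ k ih =>
    obtain ⟨P, hP, hIP, hlt⟩ := exists_isPrime_lt_of_boundaryIdeal_le hJ h
    obtain ⟨p, hp, hmono, hlast⟩ := ih P hP hIP
    refine ⟨Fin.snoc p J, fun i => ?_, Fin.strictMono_iff_lt_succ.2 fun i => ?_, Fin.snoc_last ..⟩
    · induction i using Fin.lastCases with
      | last => simpa using hJ
      | cast i => simpa using hp i
    · induction i using Fin.lastCases with
      | last => simpa [hlast] using hlt
      | cast i =>
        rw [Fin.snoc_castSucc, Fin.succ_castSucc, Fin.snoc_castSucc]
        exact hmono Fin.castSucc_lt_succ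

/-- A bounded distributive lattice without chains of `k + 1` prime ideals has complementary
sequences for all sequences of length `k`. -/
theorem exists_isComplementarySeq {k : ℕ}
    (h : ∀ p : Fin (k + 1) → Ideal T, (∀ i, (p i).IsPrime) → ¬ StrictMono p) (x : Fin k → T) :
    ∃ y, IsComplementarySeq x y := by
  -- The padding value ⊥ is never used: only indices below k enter the k-th boundary.
  let x' : ℕ → T := fun i => if hi : i < k then x ⟨i, hi⟩ else ⊥
  have hx' : ∀ j : Fin k, x' j = x j := fun j => by simp [x']
  suffices htop : ⊤ ∈ iteratedBoundary x' k by
    obtain ⟨y, hy⟩ := exists_partial_complementary x' k ⊤ htop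
    simp only [hx'] at hy
    exact ⟨y, hy⟩
  by_contra htop
  have hdisj : Disjoint (PFilter.principal (⊤ : T) : Set T) (iteratedBoundary x' k : Set T) := by
    rw [Set.disjoint_left]
    intro z hz hzI
    exact htop ((iteratedBoundary x' k).lower (PFilter.mem_principal.1 hz) hzI)
  obtain ⟨J, hJ, hle, -⟩ := DistribLattice.prime_ideal_of_disjoint_filter_ideal hdisj
  obtain ⟨p, hp, hmono, -⟩ := exists_strictMono_isPrime x' k J hJ hle
  exact h p hp hmono

end LatticeChains

/-! ### Prime ideals of a lattice given by generators and relations. -/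

namespace GenLattice

open Order

variable {S : Type*} {ent : List S → List S → Prop} {P : Ideal (GenLattice ent)}

/-- The points outside a prime ideal of a generated lattice form a model of the entailment
relation. -/
theorem exists_gen_notMem (hP : P.IsPrime) {A B : List S} (h : ent A B)
    (hA : ∀ a ∈ A, gen ent a ∉ P) : ∃ b ∈ B, gen ent b ∉ P := by
  have hmeet : ∀ A : List S, (∀ a ∈ A, gen ent a ∉ P) →
      (Quotient.mk (LatTerm.setoid ent) (LatTerm.meet A) : GenLattice ent) ∉ P := by
    intro A
    induction A with
    | nil => exact fun _ => hP.toIsProper.top_notMem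
    | cons a A ih =>
      intro hA hmem
      rcases hP.mem_or_mem (x := gen ent a)
        (y := (Quotient.mk (LatTerm.setoid ent) (LatTerm.meet A) : GenLattice ent)) hmem with h | h
      · exact hA a (by simp) h
      · exact ih (fun b hb => hA b (by simp [hb])) h
  have hjoin : ∀ B : List S, (∀ b ∈ B, gen ent b ∈ P) →
      (Quotient.mk (LatTerm.setoid ent) (LatTerm.join B) : GenLattice ent) ∈ P := by
    intro B
    induction B with
    | nil => exact fun _ => P.bot_mem
    | cons b B ih =>
      intro hB
      exact Ideal.sup_mem (x := gen ent b)
        (y := (Quotient.mk (LatTerm.setoid ent) (LatTerm.join B) : GenLattice ent))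
        (hB b (by simp)) (ih fun c hc => hB c (by simp [hc]))
  by_contra! hB
  refine hmeet A hA (P.lower ?_ (hjoin B hB))
  exact LatTerm.Le.of_ent h

/-- A prime ideal is the kernel of a lattice homomorphism to {0, 1}, hence is determined on
generators. -/
theorem eq_of_gen_mem_iff (hP : P.IsPrime) {Q : Ideal (GenLattice ent)} (hQ : Q.IsPrime)
    (h : ∀ s, gen ent s ∈ P ↔ gen ent s ∈ Q) : P = Q := by
  ext t
  obtain ⟨t, rfl⟩ := Quotient.exists_rep t
  show _ ∈ P ↔ _ ∈ Q
  induction t with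
  | gen s => exact h s
  | top => exact iff_of_false hP.toIsProper.top_notMem hQ.toIsProper.top_notMem
  | bot => exact iff_of_true P.bot_mem Q.bot_mem
  | inf a b iha ihb =>
    have key : ∀ {P : Ideal (GenLattice ent)}, P.IsPrime → ∀ x y, x ⊓ y ∈ P ↔ x ∈ P ∨ y ∈ P :=
      fun {P} hP x y => ⟨hP.mem_or_mem, fun h => h.elim (P.lower inf_le_left)
        (P.lower inf_le_right)⟩
    exact (key hP _ _).trans ((or_congr iha ihb).trans (key hQ _ _).symm)
  | sup a b iha ihb =>
    exact Ideal.sup_mem_iff.trans ((and_congr iha ihb).trans Ideal.sup_mem_iff.symm)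

end GenLattice

/-! ### Explicit dynamical proofs of the valuation ring rules. -/

namespace ValEntails

open ValAtom ValTerm

variable {R K : Type*} [CommRing R] [CommRing K] [Algebra R K]

theorem of_algebraMap (r : R) (u : Kˣ) (h : algebraMap R K r = u) : ValEntails R K [] [u] :=
  .ax (.Vr_const r) (by simp) (by
    simp only [List.mem_singleton, forall_eq]
    exact .leaf (Vr (const (algebraMap R K r))) (by simp) (by simp [h]))

theorem mul (u v : Kˣ) : ValEntails R K [u, v] [u * v] := by
  refine .ax (.const_mul (u : K) v) (by simp) ?_
  simp only [List.mem_singleton, forall_eq]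
  refine .ax (.Vr_mul (const (u : K)) (const v)) (by simp) ?_
  simp only [List.mem_singleton, forall_eq]
  refine .ax (.Vr_congr (const (u : K) * const (v : K)) (const ((u : K) * v))) (by simp) ?_
  simp only [List.mem_singleton, forall_eq]
  exact .leaf (Vr (const ((u : K) * v))) (by simp) (by simp)

theorem add (u v w : Kˣ) (h : (u : K) + v = w) : ValEntails R K [u, v] [w] := by
  refine .ax (.const_add (u : K) v) (by simp) ?_
  simp only [List.mem_singleton, forall_eq]
  refine .ax (.Vr_add (const (u : K)) (const v)) (by simp) ?_
  simp only [List.mem_singleton, forall_eq]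
  refine .ax (.Vr_congr (const (u : K) + const (v : K)) (const ((u : K) + v))) (by simp) ?_
  simp only [List.mem_singleton, forall_eq]
  exact .leaf (Vr (const ((u : K) + v))) (by simp) (by simp [h])

theorem self_or_inv (u : Kˣ) : ValEntails R K [] [u, u⁻¹] := by
  refine .ax (.const_mul (u : K) (u⁻¹ : Kˣ)) (by simp) ?_
  simp only [List.mem_singleton, forall_eq]
  refine .ax .const_one (by simp) ?_
  simp only [List.mem_singleton, forall_eq]
  -- Transitivity of equality: the two differences telescope to u · u⁻¹ - 1.
  refine .ax (.add (const (u : K) * const ((u⁻¹ : Kˣ) : K) - const (1 : K)) (const (1 : K) - 1))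
    (by simp [ValAtom.eq]) ?_
  simp only [List.mem_singleton, forall_eq, sub_add_sub_cancel]
  refine .ax (.Vr_or (const (u : K)) (const ((u⁻¹ : Kˣ) : K))) (by simp [ValAtom.eq]) ?_
  simp only [List.mem_cons, List.not_mem_nil, or_false, forall_eq_or_imp, forall_eq]
  exact ⟨.leaf (Vr (const (u : K))) (by simp) (by simp),
    .leaf (Vr (const ((u⁻¹ : Kˣ) : K))) (by simp) (by simp)⟩

theorem nil_nil [Subsingleton K] : ValEntails R K [] [] := by
  refine .ax .const_zero (by simp) ?_
  simp only [List.mem_singleton, forall_eq]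
  refine .ax .const_one (by simp) ?_
  simp only [List.mem_singleton, forall_eq, Subsingleton.elim (1 : K) 0]
  -- The constant 0 = 1 of K equals both 0 and 1 in the theory; subtracting these facts gives 1 = 0.
  refine .ax (.mul (const (0 : K) - 1) (-1)) (by simp [ValAtom.eq]) ?_
  simp only [List.mem_singleton, forall_eq]
  refine .ax (.add (const (0 : K) - 0) ((const (0 : K) - 1) * (-1))) (by simp [ValAtom.eq]) ?_
  simp only [List.mem_singleton, forall_eq]
  rw [show const (0 : K) - 0 + (const (0 : K) - 1) * (-1) = 1 by ring]
  exact .ax .one_eq_zero (by simp) (by simp)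

end ValEntails

/-! ### From prime ideals of Val(R) to valuation rings. -/

namespace ValLattice

open Order

variable {R K : Type*} [CommRing R]

theorem subsingleton_of_subsingleton [CommRing K] [Algebra R K] [Subsingleton K] :
    Subsingleton (ValLattice R K) :=
  subsingleton_of_bot_eq_top (bot_le.antisymm (LatTerm.Le.of_ent ValEntails.nil_nil))

variable [Field K] [Algebra R K]

/-- The elements of `K` that are integral for a prime ideal of the valuative lattice. -/
def IsIntegralAt (P : Ideal (ValLattice R K)) (x : K) : Prop :=
  ∀ u : Kˣ, (u : K) = x → GenLattice.gen (ValEntails R K) u ∉ P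

theorem isIntegralAt_unit {P : Ideal (ValLattice R K)} {u : Kˣ} :
    IsIntegralAt P (u : K) ↔ GenLattice.gen (ValEntails R K) u ∉ P :=
  ⟨fun h => h u rfl, fun h v hv => by rwa [Units.ext hv]⟩

variable {P : Ideal (ValLattice R K)}

theorem isIntegralAt_algebraMap (hP : P.IsPrime) (r : R) :
    IsIntegralAt P (algebraMap R K r) := by
  intro u hu
  simpa using GenLattice.exists_gen_notMem hP (ValEntails.of_algebraMap r u hu.symm) (by simp)

theorem IsIntegralAt.mul (hP : P.IsPrime) {x y : K} (hx : IsIntegralAt P x)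
    (hy : IsIntegralAt P y) : IsIntegralAt P (x * y) := by
  intro w hw
  -- Only nonzero products need checking, since 0 is integral vacuously.
  have hxy : x * y ≠ 0 := hw ▸ w.ne_zero
  obtain ⟨u, rfl⟩ := (left_ne_zero_of_mul hxy).isUnit
  obtain ⟨v, rfl⟩ := (right_ne_zero_of_mul hxy).isUnit
  obtain rfl : w = u * v := Units.ext hw
  simpa using GenLattice.exists_gen_notMem hP (ValEntails.mul u v) (by simp [hx u rfl, hy v rfl])

theorem IsIntegralAt.add (hP : P.IsPrime) {x y : K} (hx : IsIntegralAt P x)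
    (hy : IsIntegralAt P y) : IsIntegralAt P (x + y) := by
  intro w hw
  rcases eq_or_ne x 0 with rfl | hx0
  · exact hy w (by simpa using hw)
  rcases eq_or_ne y 0 with rfl | hy0
  · exact hx w (by simpa using hw)
  obtain ⟨u, rfl⟩ := hx0.isUnit
  obtain ⟨v, rfl⟩ := hy0.isUnit
  simpa using GenLattice.exists_gen_notMem hP (ValEntails.add u v w hw.symm)
    (by simp [hx u rfl, hy v rfl])

/-- The valuation ring of `K` corresponding to a prime ideal of the valuative lattice. -/
def valuationSubring (hP : P.IsPrime) : ValuationSubring K where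
  carrier := {x | IsIntegralAt P x}
  mul_mem' := IsIntegralAt.mul hP
  one_mem' := by simpa using isIntegralAt_algebraMap hP (1 : R)
  add_mem' := IsIntegralAt.add hP
  zero_mem' := by simpa using isIntegralAt_algebraMap hP (0 : R)
  neg_mem' := fun {x} hx => by
    simpa using IsIntegralAt.mul hP (isIntegralAt_algebraMap hP (-1 : R)) hx
  mem_or_inv_mem' := fun x => by
    rcases eq_or_ne x 0 with rfl | hx
    · exact .inl (by simpa using isIntegralAt_algebraMap hP (0 : R))
    obtain ⟨u, rfl⟩ := hx.isUnit
    have h := GenLattice.exists_gen_notMem hP (ValEntails.self_or_inv (R := R) u) (by simp)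
    simp only [List.mem_cons, List.not_mem_nil, or_false, exists_eq_or_imp, exists_eq_left] at h
    rw [← Units.val_inv_eq_inv_val]
    exact h.imp isIntegralAt_unit.2 isIntegralAt_unit.2

theorem unit_mem_valuationSubring (hP : P.IsPrime) {u : Kˣ} :
    (u : K) ∈ valuationSubring hP ↔ GenLattice.gen (ValEntails R K) u ∉ P :=
  isIntegralAt_unit

theorem algebraMap_mem_valuationSubring (hP : P.IsPrime) (r : R) :
    algebraMap R K r ∈ valuationSubring hP :=
  isIntegralAt_algebraMap hP r

/-- The ring is read off the complement of the ideal, which reverses inclusions; strictness holds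
because generators determine a prime. -/
theorem valuationSubring_lt {Q : Ideal (ValLattice R K)} (hP : P.IsPrime) (hQ : Q.IsPrime)
    (h : P < Q) : valuationSubring hQ < valuationSubring hP := by
  refine lt_of_le_of_ne (fun x hx u hu hmem => hx u hu (h.le hmem)) fun heq => h.ne ?_
  refine GenLattice.eq_of_gen_mem_iff hP hQ fun u => not_iff_not.1 ?_
  rw [← unit_mem_valuationSubring hP, ← unit_mem_valuationSubring hQ, heq]

end ValLattice

/-! ### From valuation rings to Krull dimension. -/

/-- A chain of `k + 1` valuation rings of `K` containing `R` yields a finitely generated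
`R`-subalgebra of `K` of Krull dimension at least `k`. -/
theorem exists_le_ringKrullDim_adjoin {R K : Type*} [CommRing R] [Field K] [Algebra R K] {k : ℕ}
    (V : Fin (k + 1) → ValuationSubring K) (hV : StrictAnti V)
    (hR : ∀ i r, algebraMap R K r ∈ V i) :
    ∃ x : Fin k → K, (k : WithBot ℕ∞) ≤ ringKrullDim (Algebra.adjoin R (Set.range x)) := by
  have hex : ∀ i : Fin k, ∃ x : K, x ∈ (V i.succ).nonunits ∧ x ∉ (V i.castSucc).nonunits := by
    intro i
    refine Set.not_subset.1 fun hle => (hV (Fin.castSucc_lt_succ (i := i))).not_ge ?_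
    exact ValuationSubring.nonunits_le_nonunits.1 hle
  choose x hx hx' using hex
  have hanti : ∀ {i j}, i ≤ j → (V i).nonunits ≤ (V j).nonunits := fun hij =>
    ValuationSubring.nonunits_le_nonunits.2 (hV.antitone hij)
  have hA : ∀ a ∈ Algebra.adjoin R (Set.range x), ∀ j, a ∈ V j := by
    intro a ha j
    induction ha using Algebra.adjoin_induction with
    | mem a ha =>
      -- Every x_i lies in the largest maximal ideal m_k, hence in V_k, the smallest ring of the
      -- chain.
      obtain ⟨i, rfl⟩ := ha
      exact hV.antitone (Fin.le_last j)
        (ValuationSubring.nonunits_subset (hanti (Fin.le_last i.succ) (hx i)))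
    | algebraMap r => exact hR j r
    | add a b _ _ ha hb => exact add_mem ha hb
    | mul a b _ _ ha hb => exact mul_mem ha hb
  let f : ∀ j, Algebra.adjoin R (Set.range x) →+* V j := fun j =>
    (Algebra.adjoin R (Set.range x)).val.toRingHom.codRestrict (V j) fun a => hA a a.2 j
  let q : Fin (k + 1) → PrimeSpectrum (Algebra.adjoin R (Set.range x)) := fun j =>
    ⟨(IsLocalRing.maximalIdeal (V j)).comap (f j), inferInstance⟩
  have hq : ∀ j (a : Algebra.adjoin R (Set.range x)),
      a ∈ (q j).asIdeal ↔ (a : K) ∈ (V j).nonunits := fun j a =>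
    (ValuationSubring.coe_mem_nonunits_iff (a := f j a)).symm
  refine ⟨x, Order.LTSeries.length_le_krullDim ⟨k, q, fun i => ?_⟩⟩
  have hle : (q i.castSucc).asIdeal ≤ (q i.succ).asIdeal := by
    intro a ha
    rw [hq] at ha ⊢
    exact hanti Fin.castSucc_lt_succ.le ha
  refine lt_of_le_not_ge hle fun hge => hx' i ?_
  exact (hq _ ⟨x i, Algebra.subset_adjoin ⟨i, rfl⟩⟩).1 (hge ((hq _ _).2 (hx i)))

theorem mainTheorem1 (R K : Type*) [CommRing R] [NoZeroDivisors R] [CommRing K] [Algebra R K]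
    [IsFractionRing R K] (n : ℤ) (hn : -1 ≤ n) (h : SmallVdimLE R K n) :
    BigVdimLE R K n := by
  -- For trivial R, K is not a field, but Val(R) is trivial and any sequence complements any other.
  rcases subsingleton_or_nontrivial R with hR | hR
  · have := (algebraMap R K).codomain_trivial
    have := ValLattice.subsingleton_of_subsingleton (R := R) (K := K)
    exact fun x => ⟨x, fun i => (Subsingleton.elim _ _).le⟩
  have : IsDomain R := NoZeroDivisors.to_isDomain R
  let : Field K := IsFractionRing.toField R
  intro x
  refine exists_isComplementarySeq (fun p hp hmono => ?_) x
  obtain ⟨a, ha⟩ := exists_le_ringKrullDim_adjoin (R := R)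
    (fun i => ValLattice.valuationSubring (hp i))
    (fun i j hij => ValLattice.valuationSubring_lt (hp i) (hp j) (hmono hij))
    (fun i => ValLattice.algebraMap_mem_valuationSubring (hp i))
  exact ha.not_gt (h _ a)
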